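/- \textbf{Definitions.} Identify a partition $P=[1^{f_1}2^{f_2}\cdots]$ with the finitely supported sequence $f=(f_1,f_2,\ldots)$ of its frequencies, $f_i\ge 0$ being the number of parts of $P$ equal to $i$. A \emph{spread} of $f$ is a maximal nonempty interval $[i,j]$ of positive integers on which $f$ does not vanish, and $R(f)$ is the union of the sets $\{j,j-2,j-4,\ldots\}\cap[i,j]$ over all spreads $[i,j]$ of $f$. Burge's operator $\partial$ is defined as follows: $\partial f$ is obtained from $f$ by replacing $(f_{j-1},f_j)$ with $(f_{j-1}+1,f_j-1)$ simultaneously for all $j\in R(f)$ (for $j=1$ only $f_1$ is lowered by $1$), and $\partial P$ is the partition with frequency sequence $\partial f$. The \emph{Jordan type} of a nilpotent endomorphism of a finite-dimensional vector space is the partition formed by the sizes of its Jordan blocks. \textbf{Theorem.} Let $F$ be a field, let $n\ge 0$, let $B\in M_n(F)$ be nilpotent of Jordan type $P$, and let $\mathcal N_B=\{A\in M_n(F): AB=BA,\ A \text{ nilpotent}\}$. (1) Suppose that $F$ is infinite. Then for a generic $A\in\mathcal N_B$, i.e. for all $A$ in some subset of $\mathcal N_B$ that is open and dense in $\mathcal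 N_B$ for the Zariski topology (whose closed sets are the common zero sets in $M_n(F)$ of polynomials over $F$ in the $n^2$ matrix entries), the subspace $W=\operatorname{im}A$ is invariant under $B$ and the restriction $B|_W$ has Jordan type $\partial P$. (2) Over an arbitrary field $F$, finite or infinite, there exists $A\in\mathcal N_B$ such that $B|_{\operatorname{im}A}$ has Jordan type $\partial P$. -/

import Mathlib

noncomputable section

/-! ### Burge's operator on frequency sequences and on partitions

A partition `[1^{f_1} 2^{f_2} ⋯]` is encoded by its finitely supported sequence of frequencies
`f : ℕ →₀ ℕ`; only the entries at positive indices matter. -/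

/-- `[i, j]` is a spread of `f`: a maximal (nonempty) interval of positive integers on which
`f` does not vanish. -/
def IsSpread (f : ℕ →₀ ℕ) (i j : ℕ) : Prop :=
  1 ≤ i ∧ i ≤ j ∧ (∀ m, i ≤ m → m ≤ j → f m ≠ 0) ∧ (i = 1 ∨ f (i - 1) = 0) ∧ f (j + 1) = 0

/-- The set `R(f)`: the union, over all spreads `[i, j]` of `f`, of `{j, j - 2, j - 4, …} ∩ [i, j]`,
i.e. the positions of the right entries of the backward pairs of `f`. -/
def burgeR (f : ℕ →₀ ℕ) : Set ℕ :=
  {m | ∃ i j t, IsSpread f i j ∧ i ≤ m ∧ m + 2 * t = j}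

theorem ne_zero_of_mem_burgeR {f : ℕ →₀ ℕ} {m : ℕ} (h : m ∈ burgeR f) : f m ≠ 0 := by
  obtain ⟨i, j, t, hs, him, hj⟩ := h
  exact hs.2.2.1 m him (by omega)

open Classical in
/-- Burge's operator `∂` on frequency sequences: for every `j ∈ R(f)`, the entry `f_j` is lowered
by one and the entry `f_{j-1}` is raised by one (the entry `f_0` being ignored).
The subtraction never truncates, because `f_m ≥ 1` for `m ∈ R(f)`. -/
def burgeFreq (f : ℕ →₀ ℕ) : ℕ →₀ ℕ :=
  Finsupp.onFinset (f.support ∪ f.support.image Nat.pred)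
    (fun m => if m = 0 then 0 else
      f m + (if m + 1 ∈ burgeR f then 1 else 0) - (if m ∈ burgeR f then 1 else 0))
    (by
      intro m hm
      by_cases h : f m = 0
      · have h1 : m + 1 ∈ burgeR f := by
          by_contra h1
          simp [h, h1] at hm
        refine Finset.mem_union_right _ (Finset.mem_image.2 ⟨m + 1, ?_, rfl⟩)
        exact Finsupp.mem_support_iff.2 (ne_zero_of_mem_burgeR h1)
      · exact Finset.mem_union_left _ (Finsupp.mem_support_iff.2 h))

/-- Burge's operator `∂` on partitions, via frequency sequences. -/
def burgePartition {n : ℕ} (P : n.Partition) :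
    (Finsupp.toMultiset (burgeFreq (Multiset.toFinsupp P.parts))).sum.Partition :=
  Nat.Partition.ofMultiset (Finsupp.toMultiset (burgeFreq (Multiset.toFinsupp P.parts)))

/-! ### Jordan types of nilpotent endomorphisms -/

/-- `T` is nilpotent of Jordan type `P`: there is a basis `v_{i,k,h}` (`i` a part of `P`,
`k` running over the copies of `i` in `P`, and `0 ≤ h < i`) which consists of Jordan chains
`v_{i,k,0} ↦ v_{i,k,1} ↦ ⋯ ↦ v_{i,k,i-1} ↦ 0` of `T`. -/
def HasJordanType {F V : Type*} [Field F] [AddCommGroup V] [Module F V]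
    (T : Module.End F V) {m : ℕ} (P : m.Partition) : Prop :=
  ∃ v : Module.Basis (Σ i : ℕ, Fin (P.parts.count i) × Fin i) F V,
    ∀ (i : ℕ) (k : Fin (P.parts.count i)) (h : Fin i),
      T (v ⟨i, k, h⟩) =
        if hh : (h : ℕ) + 1 < i then v ⟨i, k, ⟨(h : ℕ) + 1, hh⟩⟩ else 0

/-- The subspace `W` is invariant under `T`, and the restriction `T|_W` has Jordan type `P`. -/
def RestrictionHasJordanType {F V : Type*} [Field F] [AddCommGroup V] [Module F V]
    (T : Module.End F V) (W : Submodule F V) {m : ℕ} (P : m.Partition) : Prop :=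
  ∃ hW : ∀ x ∈ W, T x ∈ W, HasJordanType (T.restrict hW) P

/-! ### The nilpotent commutator and generic elements -/

/-- The nilpotent commutator of `B`: all nilpotent matrices that commute with `B`. -/
def nilpotentCommutator {F : Type*} [Field F] {n : ℕ} (B : Matrix (Fin n) (Fin n) F) :
    Set (Matrix (Fin n) (Fin n) F) :=
  {A | A * B = B * A ∧ IsNilpotent A}

/-- Zariski closed sets of matrices: the zero loci of ideals of polynomials in the entries. -/
def IsZariskiClosed {F : Type*} [Field F] {n : ℕ} (Z : Set (Matrix (Fin n) (Fin n) F)) : Prop :=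
  ∃ I : Ideal (MvPolynomial (Fin n × Fin n) F),
    Z = {A | (fun ij : Fin n × Fin n => A ij.1 ij.2) ∈ MvPolynomial.zeroLocus F I}

/-- A property holds for a generic element of `X`: it holds on a subset of `X` that is open and
dense in `X` for the Zariski topology. -/
def HoldsGenerically {F : Type*} [Field F] {n : ℕ} (X : Set (Matrix (Fin n) (Fin n) F))
    (p : Matrix (Fin n) (Fin n) F → Prop) : Prop :=
  ∃ U : Set (Matrix (Fin n) (Fin n) F),
    (∃ Z, IsZariskiClosed Z ∧ U = X \ Z) ∧
    (∀ Z, IsZariskiClosed Z → U ⊆ Z → X ⊆ Z) ∧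
    ∀ A ∈ U, p A

end

/-! ### The set `R(f)` -/

/-! Let `b` be the given nilpotent map, `c i` its number of Jordan blocks of size `i`, and `R =
R(f)`. A nilpotent Jordan type is recovered from the second differences of the ranks of the powers,
and if `a` commutes with `b`, the `m`-th power of `b` restricted to `im a` has rank `rank (b ^ m *
a)`. The theorem therefore reduces to `rank (b ^ m * a) = rank (b ^ m) - #{j ∈ R | m < j}` for all
`m`: the second difference of the correction removes a part `m + 1` when `m + 1 ∈ R` and adds one
when `m + 2 ∈ R`, which is Burge's rule.

The right side bounds the rank for every nilpotent `a` commuting with `b`. Indeed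
`exists_isTriangular` finds a Jordan basis of `b` in which `a` is strictly triangular on the blocks
of each size, and `finrank_range_pow_mul_le` then bounds the range by counting spanning vectors. In
any Jordan basis the bound is attained for all `m` at once by the triangular map `burgeEnd`, over
any field; this gives (2).

For (1), triangular maps in a fixed Jordan basis form a linear space of nilpotents. So each `A` in
the commutator lies on a line inside the commutator that contains a map of maximal ranks. Maximality
is the nonvanishing of certain polynomials, and over an infinite field a nonzero polynomial on a
line has dense nonvanishing locus (`holdsGenerically_of_lines`). -/

theorem pos_of_mem_burgeR {f : ℕ →₀ ℕ} {m : ℕ} (h : m ∈ burgeR f) : 1 ≤ m := by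
  obtain ⟨i, j, t, hs, him, hj⟩ := h
  exact hs.1.trans him

/-- Neighbouring points lie in spreads with the same right end, since a spread is followed by a zero
of `f`; the distances to that end have opposite parity. -/
theorem succ_notMem_burgeR {f : ℕ →₀ ℕ} {m : ℕ} (h : m ∈ burgeR f) : m + 1 ∉ burgeR f := by
  rintro ⟨i', j', t', ⟨-, -, hn', -, hz'⟩, him', hj'⟩
  obtain ⟨i, j, t, ⟨-, -, hn, -, hz⟩, him, hj⟩ := h
  have h1 : ¬ j < j' := fun hlt => by
    rcases Nat.lt_or_ge m j with hm | hm
    · exact hn' (j + 1) (by omega) (by omega) hz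
    · have : j = m := by omega
      subst this
      exact hn' (j + 1) him' (by omega) hz
  have h2 : ¬ j' < j := fun hlt => hn (j' + 1) (by omega) (by omega) hz'
  omega

theorem exists_isSpread {f : ℕ →₀ ℕ} {m : ℕ} (hm : 1 ≤ m) (hf : f m ≠ 0) :
    ∃ i j, IsSpread f i j ∧ i ≤ m ∧ m ≤ j := by
  classical
  have hlow : ∃ i, 1 ≤ i ∧ i ≤ m ∧ (∀ l, i ≤ l → l ≤ m → f l ≠ 0) ∧ (i = 1 ∨ f (i - 1) = 0) := by
    induction m, hm using Nat.le_induction with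
    | base => exact ⟨1, le_rfl, le_rfl, fun l h1 h2 => le_antisymm h2 h1 ▸ hf, Or.inl rfl⟩
    | succ m hm ih =>
      by_cases h0 : f m = 0
      · exact ⟨m + 1, by omega, le_rfl, fun l h1 h2 => le_antisymm h2 h1 ▸ hf, Or.inr h0⟩
      · obtain ⟨i, h1, h2, h3, h4⟩ := ih h0
        refine ⟨i, h1, by omega, fun l hl hl' => ?_, h4⟩
        rcases Nat.lt_or_ge m l with h | h
        · exact (show m + 1 = l by omega) ▸ hf
        · exact h3 l hl h
  have hup : ∃ s, f (m + s + 1) = 0 := by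
    by_contra! hne
    refine Set.infinite_of_injective_forall_mem (f := fun s => m + s + 1)
      (fun a b hab => by simpa using hab) (s := (f.support : Set ℕ)) (fun s => ?_)
      f.support.finite_toSet
    simpa using hne s
  obtain ⟨i, h1, h2, h3, h4⟩ := hlow
  refine ⟨i, m + Nat.find hup, ⟨h1, by omega, fun l hl hl' => ?_, h4, Nat.find_spec hup⟩, h2,
    by omega⟩
  rcases Nat.lt_or_ge m l with h | h
  · have := Nat.find_min hup (m := l - m - 1) (by omega)
    rwa [show m + (l - m - 1) + 1 = l by omega] at this
  · exact h3 l hl h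

theorem mem_burgeR_or_succ_mem {f : ℕ →₀ ℕ} {m : ℕ} (hm : 1 ≤ m) (hf : f m ≠ 0) :
    m ∈ burgeR f ∨ m + 1 ∈ burgeR f := by
  obtain ⟨i, j, hs, h1, h2⟩ := exists_isSpread hm hf
  obtain ⟨t, ht | ht⟩ := Nat.even_or_odd' (j - m)
  · exact Or.inl ⟨i, j, t, hs, h1, by omega⟩
  · exact Or.inr ⟨i, j, t, hs, by omega, by omega⟩

/-! ### Jordan bases -/

/-- The indices `(i, k, h)` of a Jordan basis with `c i` blocks of size `i`. -/
abbrev JordanIndex (c : ℕ → ℕ) : Type := Σ i : ℕ, Fin (c i) × Fin i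

section JordanBasis

variable {F V : Type*} [Field F] [AddCommGroup V] [Module F V] {c : ℕ → ℕ}

/-- The basis `v` consists of Jordan chains of `b`. -/
def IsJordanBasis (v : Module.Basis (JordanIndex c) F V) (b : Module.End F V) : Prop :=
  ∀ (i : ℕ) (k : Fin (c i)) (h : Fin i),
    b (v ⟨i, k, h⟩) = if hh : (h : ℕ) + 1 < i then v ⟨i, k, ⟨(h : ℕ) + 1, hh⟩⟩ else 0

/-- The vector `v (i, k, h)` if this is an index, and zero otherwise. -/
noncomputable def chainVec (v : Module.Basis (JordanIndex c) F V) (i k h : ℕ) : V :=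
  if H : k < c i ∧ h < i then v ⟨i, ⟨k, H.1⟩, ⟨h, H.2⟩⟩ else 0

theorem chainVec_coe (v : Module.Basis (JordanIndex c) F V) (x : JordanIndex c) :
    chainVec v x.1 x.2.1 x.2.2 = v x := by
  obtain ⟨i, k, h⟩ := x
  simp [chainVec]

theorem chainVec_of_le (v : Module.Basis (JordanIndex c) F V) {i k h : ℕ} (H : i ≤ h) :
    chainVec v i k h = 0 := by
  rw [chainVec, dif_neg]; omega

theorem repr_chainVec (v : Module.Basis (JordanIndex c) F V) (i k h : ℕ) (y : JordanIndex c) :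
    v.repr (chainVec v i k h) y =
      if y.1 = i ∧ (y.2.1 : ℕ) = k ∧ (y.2.2 : ℕ) = h then 1 else 0 := by
  obtain ⟨i', k', h'⟩ := y
  rw [chainVec]
  split_ifs with H H' H'
  · obtain ⟨rfl, rfl, rfl⟩ := H'
    simp
  · rw [v.repr_self, Finsupp.single_apply, if_neg]
    rintro heq
    apply H'
    obtain ⟨rfl, h2⟩ := Sigma.mk.inj_iff.1 heq
    obtain ⟨rfl, rfl⟩ := Prod.mk_inj.1 (eq_of_heq h2)
    simp
  · obtain ⟨rfl, rfl, rfl⟩ := H'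
    exact absurd ⟨k'.2, h'.2⟩ H
  · simp

variable {v : Module.Basis (JordanIndex c) F V} {b : Module.End F V}

namespace IsJordanBasis

theorem apply_chainVec (hv : IsJordanBasis v b) (i k h : ℕ) :
    b (chainVec v i k h) = chainVec v i k (h + 1) := by
  by_cases H : k < c i ∧ h < i
  · rw [chainVec, dif_pos H, hv, chainVec]
    by_cases H' : h + 1 < i
    · rw [dif_pos H', dif_pos ⟨H.1, H'⟩]
    · rw [dif_neg H', dif_neg (by omega)]
  · rw [chainVec, dif_neg H, map_zero, chainVec, dif_neg (by omega)]

theorem pow_apply_chainVec (hv : IsJordanBasis v b) (m i k h : ℕ) :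
    (b ^ m) (chainVec v i k h) = chainVec v i k (h + m) := by
  induction m with
  | zero => simp
  | succ m ih => rw [pow_succ', Module.End.mul_apply, ih, hv.apply_chainVec, add_assoc]

theorem repr_pow_apply (hv : IsJordanBasis v b) (m : ℕ) (x : V) (i : ℕ) (k : Fin (c i))
    (h : Fin i) :
    v.repr ((b ^ m) x) ⟨i, k, h⟩ =
      if m ≤ h then v.repr x ⟨i, k, ⟨h - m, by omega⟩⟩ else 0 := by
  have key : v.coord ⟨i, k, h⟩ ∘ₗ (b ^ m) =
      if m ≤ h then v.coord ⟨i, k, ⟨h - m, by omega⟩⟩ else 0 := by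
    refine v.ext fun y => ?_
    rw [LinearMap.comp_apply, ← chainVec_coe v y, hv.pow_apply_chainVec]
    split_ifs with hm
    · simp only [Module.Basis.coord_apply, repr_chainVec]
      congr 1
      simp only [eq_iff_iff]
      omega
    · rw [Module.Basis.coord_apply, repr_chainVec, if_neg (by dsimp only; omega)]
      rfl
  have := LinearMap.congr_fun key x
  split_ifs at this ⊢ with hm
  · simpa using this
  · simpa using this

/-- A coefficient of an endomorphism commuting with `b` vanishes unless `h ≤ h'` and
`i' - h' ≤ i - h`. -/
theorem repr_apply_ne_zero (hv : IsJordanBasis v b) {a : Module.End F V} (ha : Commute a b)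
    {x y : JordanIndex c} (hxy : v.repr (a (v x)) y ≠ 0) :
    (x.2.2 : ℕ) ≤ y.2.2 ∧ y.1 + x.2.2 ≤ x.1 + y.2.2 := by
  obtain ⟨i, k, h⟩ := x
  obtain ⟨i', k', h'⟩ := y
  dsimp only at hxy ⊢
  constructor
  · by_contra hlt
    apply hxy
    -- The vector lies in the range of `b ^ h`, hence so does its image under `a`.
    have h1 : v ⟨i, k, h⟩ = (b ^ (h : ℕ)) (chainVec v i k 0) := by
      rw [hv.pow_apply_chainVec, zero_add, ← chainVec_coe v ⟨i, k, h⟩]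
    rw [h1, ← Module.End.mul_apply, (ha.pow_right h).eq, Module.End.mul_apply, hv.repr_pow_apply,
      if_neg hlt]
  · by_contra hlt
    apply hxy
    -- The vector is killed by `b ^ (i - h)`, hence so is its image under `a`.
    have h1 : (b ^ (i - h)) (a (v ⟨i, k, h⟩)) = 0 := by
      rw [← Module.End.mul_apply, ← (ha.pow_right _).eq, Module.End.mul_apply,
        ← chainVec_coe v ⟨i, k, h⟩, hv.pow_apply_chainVec, chainVec_of_le, map_zero]
      dsimp only; omega
    have h2 := hv.repr_pow_apply (i - h) (a (v ⟨i, k, h⟩)) i' k' ⟨h' + (i - h), by omega⟩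
    rw [h1, if_pos (by simp)] at h2
    simpa using h2.symm

/-- The coefficients of an endomorphism commuting with `b` between blocks of equal size do not
depend on the position in the block. -/
theorem repr_apply_diag (hv : IsJordanBasis v b) {a : Module.End F V} (ha : Commute a b)
    {i : ℕ} (k l : Fin (c i)) (h h' : Fin i) :
    v.repr (a (v ⟨i, k, h⟩)) ⟨i, l, h⟩ = v.repr (a (v ⟨i, k, h'⟩)) ⟨i, l, h'⟩ := by
  have key : ∀ h : Fin i, v.repr (a (v ⟨i, k, h⟩)) ⟨i, l, h⟩ =
      v.repr (a (v ⟨i, k, ⟨0, h.pos⟩⟩)) ⟨i, l, ⟨0, h.pos⟩⟩ := by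
    intro h
    have h1 : v ⟨i, k, h⟩ = (b ^ (h : ℕ)) (v ⟨i, k, ⟨0, h.pos⟩⟩) := by
      rw [← chainVec_coe v ⟨i, k, ⟨0, h.pos⟩⟩, hv.pow_apply_chainVec, zero_add,
        ← chainVec_coe v ⟨i, k, h⟩]
    rw [h1, ← Module.End.mul_apply, (ha.pow_right h).eq, Module.End.mul_apply, hv.repr_pow_apply,
      if_pos le_rfl]
    simp
  rw [key h, key h']

end IsJordanBasis

/-- `a` commutes with `b`, and is strictly triangular on the blocks of each size. -/
def IsTriangular (v : Module.Basis (JordanIndex c) F V) (b a : Module.End F V) : Prop :=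
  Commute a b ∧ ∀ (i : ℕ) (k l : Fin (c i)) (h : Fin i),
    v.repr (a (v ⟨i, k, h⟩)) ⟨i, l, h⟩ ≠ 0 → k < l

/-- Unlike nilpotency, triangularity in a fixed basis is a linear condition; this keeps lines inside
the nilpotent commutator. -/
theorem IsTriangular.add_smul {a a' : Module.End F V} (ha : IsTriangular v b a)
    (ha' : IsTriangular v b a') (s t : F) : IsTriangular v b (s • a + t • a') := by
  refine ⟨(ha.1.smul_left s).add_left (ha'.1.smul_left t), fun i k l h hne => ?_⟩
  by_contra hkl
  apply hne
  have h1 : v.repr (a (v ⟨i, k, h⟩)) ⟨i, l, h⟩ = 0 := not_not.1 fun h => hkl (ha.2 _ _ _ _ h)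
  have h2 : v.repr (a' (v ⟨i, k, h⟩)) ⟨i, l, h⟩ = 0 := not_not.1 fun h => hkl (ha'.2 _ _ _ _ h)
  simp [h1, h2]

theorem IsTriangular.isNilpotent (hv : IsJordanBasis v b) [Module.Finite F V]
    {a : Module.End F V} (ha : IsTriangular v b a) : IsNilpotent a := by
  classical
  have : Fintype (JordanIndex c) := FiniteDimensional.fintypeBasisIndex v
  obtain ⟨N, hN⟩ : ∃ N : ℕ, ∀ x : JordanIndex c, x.1 < N ∧ (x.2.1 : ℕ) < N := by
    refine ⟨∑ x : JordanIndex c, (x.1 + x.2.1 + 1), fun x => ?_⟩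
    have := Finset.single_le_sum (f := fun x : JordanIndex c => x.1 + (x.2.1 : ℕ) + 1)
      (fun _ _ => Nat.zero_le _) (Finset.mem_univ x)
    omega
  -- A weight that `a` strictly raises, lexicographic in `2h - i` and `k`. The two inequalities of
  -- `repr_apply_ne_zero` add up to monotonicity of `2h - i`, with equality only for equal `i` and
  -- `h`, where triangularity raises `k`.
  let w : JordanIndex c → ℕ := fun x => (2 * (x.2.2 : ℕ) + N - x.1) * N + x.2.1
  have hstep : ∀ x y, v.repr (a (v x)) y ≠ 0 → w x < w y := by
    rintro ⟨i, k, h⟩ ⟨i', k', h'⟩ hne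
    obtain ⟨h1, h2⟩ := hv.repr_apply_ne_zero ha.1 hne
    have hx := hN ⟨i, k, h⟩
    have hy := hN ⟨i', k', h'⟩
    dsimp only [w] at h1 h2 hx hy ⊢
    by_cases hlt : 2 * (h : ℕ) + N - i < 2 * (h' : ℕ) + N - i'
    · have := Nat.mul_le_mul_right N hlt
      rw [Nat.succ_mul] at this
      omega
    · obtain rfl : i = i' := by omega
      obtain rfl : h = h' := Fin.ext (by omega)
      have := ha.2 _ _ _ _ hne
      simpa using this
  have hpow : ∀ n : ℕ, ∀ x y, v.repr ((a ^ n) (v x)) y ≠ 0 → w x + n ≤ w y := by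
    intro n
    induction n with
    | zero =>
      intro x y hne
      by_cases hxy : x = y
      · simp [hxy]
      · simp [hxy] at hne
    | succ n ih =>
      intro x y hne
      rw [pow_succ', Module.End.mul_apply, ← v.sum_repr ((a ^ n) (v x))] at hne
      simp only [map_sum, map_smul, Finsupp.coe_finsetSum, Finset.sum_apply, Finsupp.smul_apply,
        smul_eq_mul] at hne
      obtain ⟨z, -, hz⟩ := Finset.exists_ne_zero_of_sum_ne_zero hne
      have h1 := ih x z (left_ne_zero_of_mul hz)
      have h2 := hstep z y (right_ne_zero_of_mul hz)
      omega
  refine ⟨∑ x, w x + 1, v.ext fun x => v.ext_elem fun y => ?_⟩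
  by_contra hne
  have h1 := hpow _ x y (by simpa using hne)
  have := Finset.single_le_sum (f := w) (fun _ _ => Nat.zero_le _) (Finset.mem_univ y)
  omega

end JordanBasis

/-! ### Ranks of triangular endomorphisms -/

section Ranks

variable {F V : Type*} [Field F] [AddCommGroup V] [Module F V] {c : ℕ → ℕ}

/-- The rank of the `m`-th power of a nilpotent endomorphism with `c i` Jordan blocks of
size `i`. -/
noncomputable def powRank (c : ℕ → ℕ) (m : ℕ) : ℕ := {x : JordanIndex c | m ≤ (x.2.2 : ℕ)}.ncard

/-- The number of elements of `R` that exceed `m`. -/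
noncomputable def countAbove (R : Set ℕ) (m : ℕ) : ℕ := {j | j ∈ R ∧ m < j}.ncard

/-- `R` consists of sizes of blocks, contains no two consecutive numbers, and meets
`{i, i + 1}` for each block size `i`. -/
structure IsBurgeSet (c : ℕ → ℕ) (R : Set ℕ) : Prop where
  pos : ∀ {i}, i ∈ R → 1 ≤ i
  ne_zero : ∀ {i}, i ∈ R → c i ≠ 0
  succ_notMem : ∀ {i}, i ∈ R → i + 1 ∉ R
  mem_or : ∀ {i}, 1 ≤ i → c i ≠ 0 → i ∈ R ∨ i + 1 ∈ R

theorem isBurgeSet_burgeR (f : ℕ →₀ ℕ) : IsBurgeSet f (burgeR f) where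
  pos := pos_of_mem_burgeR
  ne_zero := ne_zero_of_mem_burgeR
  succ_notMem := succ_notMem_burgeR
  mem_or := mem_burgeR_or_succ_mem

theorem IsBurgeSet.finite {R : Set ℕ} (hR : IsBurgeSet c R) [Finite (JordanIndex c)] :
    R.Finite := by
  refine (Set.finite_range (fun x : JordanIndex c => x.1)).subset fun i hi => ?_
  exact ⟨⟨i, ⟨0, Nat.pos_of_ne_zero (hR.ne_zero hi)⟩, ⟨0, hR.pos hi⟩⟩, rfl⟩

/-! ### Counting elements of a Burge set between two sizes -/

section Count

variable {R : Set ℕ} (m : ℕ)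

open Classical in
/-- The number of elements of `R` in the open interval from `m` to `i`. -/
noncomputable def countBetween (R : Set ℕ) (m : ℕ) : ℕ → ℕ
  | 0 => 0
  | i + 1 => countBetween R m i + if i ∈ R ∧ m < i then 1 else 0

theorem countBetween_mono {i j : ℕ} (h : i ≤ j) : countBetween R m i ≤ countBetween R m j :=
  monotone_nat_of_le_succ (fun i => by rw [countBetween]; omega) h

theorem countBetween_le_add {i j : ℕ} (h : i ≤ j) :
    countBetween R m j + i ≤ countBetween R m i + j := by
  classical
  induction j, h using Nat.le_induction with
  | base => rfl
  | succ j _ ih =>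
    rw [countBetween]
    split_ifs <;> omega

theorem countBetween_lt {i j : ℕ} (hi : i ∈ R) (hm : m < i) (h : i < j) :
    countBetween R m i < countBetween R m j := by
  classical
  refine lt_of_lt_of_le ?_ (countBetween_mono m (Nat.succ_le_of_lt h))
  rw [countBetween, if_pos ⟨hi, hm⟩]
  omega

/-- The count has slope at most one, and it does not grow from `j - 1` to `j` because `j - 1 ∉ R`.
-/
theorem countBetween_lt_add (hR : IsBurgeSet c R) {i j : ℕ} (hj : j ∈ R) (h : i < j) :
    countBetween R m j + i < countBetween R m i + j := by
  classical
  obtain ⟨l, rfl⟩ : ∃ l, j = l + 1 := ⟨j - 1, by omega⟩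
  have h1 := countBetween_le_add (R := R) m (show i ≤ l by omega)
  have h2 : countBetween R m (l + 1) = countBetween R m l := by
    rw [countBetween, if_neg (fun hl => hR.succ_notMem hl.1 hj), add_zero]
  omega

theorem add_countBetween_lt {j : ℕ} (hm : m < j) : m + countBetween R m j < j := by
  classical
  have h1 := countBetween_le_add (R := R) m (show m + 1 ≤ j from hm)
  have h2 : countBetween R m (m + 1) = 0 := by
    have h3 : ∀ i ≤ m + 1, countBetween R m i = 0 := by
      intro i
      induction i with
      | zero => exact fun _ => rfl
      | succ i ih =>
        intro hi
        rw [countBetween, ih (by omega), if_neg (by omega)]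
    exact h3 _ le_rfl
  omega

end Count

theorem ncard_le_finrank_span {ι : Type*} (v : Module.Basis ι F V) [Module.Finite F V]
    (s : Set ι) (W : Submodule F V) (h : ∀ i ∈ s, v i ∈ W) : s.ncard ≤ Module.finrank F W := by
  have := Module.Finite.finite_basis v
  have : Fintype s := Fintype.ofFinite s
  have hli : LinearIndependent F (fun i : s => (⟨v i, h i i.2⟩ : W)) :=
    LinearIndependent.of_comp W.subtype (v.linearIndependent.comp _ Subtype.val_injective)
  rw [← Nat.card_coe_set_eq, Nat.card_eq_fintype_card]
  exact hli.fintype_card_le_finrank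

theorem finrank_le_ncard {ι : Type*} [Finite ι] (g : ι → V) (s : Set ι) (W : Submodule F V)
    (h : W ≤ Submodule.span F (g '' s)) : Module.finrank F W ≤ s.ncard := by
  classical
  have : Fintype s := Fintype.ofFinite s
  have h2 : Set.range (fun i : s => g i) = g '' s := by
    rw [← Set.image_eq_range]
  rw [← h2] at h
  have hfin : Module.Finite F (Submodule.span F (Set.range fun i : s => g i)) :=
    Module.Finite.span_of_finite F (Set.finite_range _)
  refine (Submodule.finrank_mono h).trans ((finrank_range_le_card (fun i : s => g i)).trans ?_)
  rw [← Nat.card_coe_set_eq, Nat.card_eq_fintype_card]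

variable {v : Module.Basis (JordanIndex c) F V} {b : Module.End F V} {R : Set ℕ}

namespace IsJordanBasis

theorem finrank_range_pow (hv : IsJordanBasis v b) [Module.Finite F V] (m : ℕ) :
    Module.finrank F (LinearMap.range (b ^ m)) = powRank c m := by
  have := Module.Finite.finite_basis v
  apply le_antisymm
  · refine finrank_le_ncard v _ _ ?_
    rw [LinearMap.range_eq_map, ← v.span_eq, Submodule.map_span, Submodule.span_le]
    rintro _ ⟨_, ⟨x, rfl⟩, rfl⟩
    rw [← chainVec_coe v, hv.pow_apply_chainVec]
    by_cases h : x.1 ≤ x.2.2 + m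
    · rw [chainVec_of_le v h]
      exact zero_mem _
    · refine Submodule.subset_span ⟨⟨x.1, x.2.1, ⟨x.2.2 + m, by omega⟩⟩, ?_, ?_⟩
      · simp
      · rw [← chainVec_coe v]
  · refine ncard_le_finrank_span v _ _ fun x hx => ?_
    refine ⟨chainVec v x.1 x.2.1 (x.2.2 - m), ?_⟩
    rw [hv.pow_apply_chainVec, ← chainVec_coe v x, Nat.sub_add_cancel hx]

/-- The range is spanned by the images `a (v x)` with `x` in `H`, and `H` has `powRank c m`
elements. Call `x` high if its position is at least `m + countBetween R m x.1`. Because this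
threshold grows with slope 0 or 1 in the size, `a` maps high basis vectors into the span of high
ones, and the strict inequalities at elements of `R` keep the image off the set `S` of high vectors.
So the high vectors outside `S`, together with the images of the others in `H`, span the range. -/
theorem finrank_range_pow_mul_le (hv : IsJordanBasis v b) [Module.Finite F V]
    (hR : IsBurgeSet c R) {a : Module.End F V} (ha : IsTriangular v b a) (m : ℕ) :
    Module.finrank F (LinearMap.range (b ^ m * a)) + countAbove R m ≤ powRank c m := by
  classical
  have := Module.Finite.finite_basis v
  set H : Set (JordanIndex c) := {x | m ≤ (x.2.2 : ℕ)} with hH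
  -- One index for each `j ∈ R` above `m`: the first block of size `j`, exactly at the threshold.
  let S : Set (JordanIndex c) := {x | x.1 ∈ R ∧ (x.2.1 : ℕ) = 0 ∧
    (x.2.2 : ℕ) = m + countBetween R m x.1}
  let g : JordanIndex c → V := fun x =>
    if m + countBetween R m x.1 ≤ x.2.2 then v x else a (v x)
  have hSH : S ⊆ H := fun x hx => by
    have := hx.2.2
    simp only [hH, Set.mem_ofPred_eq]
    omega
  have hS : countAbove R m ≤ S.ncard := by
    refine le_trans (Set.ncard_le_ncard ?_ (Set.toFinite _)) (Set.ncard_image_le (f := Sigma.fst))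
    rintro j ⟨hj, hm⟩
    exact ⟨⟨j, ⟨0, Nat.pos_of_ne_zero (hR.ne_zero hj)⟩, ⟨_, add_countBetween_lt m hm⟩⟩,
      ⟨hj, rfl, rfl⟩, rfl⟩
  have hspan : ∀ x ∈ H, a (v x) ∈ Submodule.span F (g '' (H \ S)) := by
    rintro ⟨i, k, h⟩ hx
    by_cases hU : m + countBetween R m i ≤ h
    · have : Fintype (JordanIndex c) := Fintype.ofFinite _
      rw [← v.sum_repr (a (v _))]
      refine Submodule.sum_mem _ fun y _ => ?_
      by_cases hne : v.repr (a (v ⟨i, k, h⟩)) y = 0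
      · rw [hne, zero_smul]
        exact zero_mem _
      refine Submodule.smul_mem _ _ (Submodule.subset_span ?_)
      obtain ⟨h1, h2⟩ := hv.repr_apply_ne_zero ha.1 hne
      obtain ⟨i', k', h'⟩ := y
      have hh := h.2
      have hh' := h'.2
      dsimp only [hH, Set.mem_ofPred_eq] at h1 h2 hx
      refine ⟨⟨i', k', h'⟩, ⟨hx.trans h1, ?_⟩, ?_⟩
      · rintro ⟨hR', h0, he⟩
        dsimp only at hR' h0 he
        -- No index of `S` is reached. From a smaller size, the threshold would have to grow with
        -- slope one up to `i' ∈ R`; from a larger size, it has already jumped past `i'`; at equal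
        -- size, triangularity would need a block before the first.
        rcases lt_trichotomy i i' with hlt | rfl | hlt
        · have := countBetween_lt_add m hR hR' hlt
          omega
        · obtain rfl : h = h' := Fin.ext (by omega)
          have := ha.2 _ _ _ _ hne
          rw [Fin.lt_def] at this
          omega
        · have := countBetween_lt m hR' (by omega) hlt
          omega
      · rw [show g ⟨i', k', h'⟩ = v ⟨i', k', h'⟩ from if_pos ?_]
        dsimp only
        rcases le_total i i' with hle | hle
        · have := countBetween_le_add (R := R) m hle
          omega
        · have := countBetween_mono (R := R) m hle
          omega
    · refine Submodule.subset_span ⟨⟨i, k, h⟩, ⟨hx, fun hS => hU hS.2.2.ge⟩, ?_⟩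
      exact if_neg hU
  have hle : Module.finrank F (LinearMap.range (b ^ m * a)) ≤ (H \ S).ncard := by
    refine finrank_le_ncard g _ _ ?_
    rw [← (ha.1.pow_right m).eq, LinearMap.range_eq_map, ← v.span_eq, Submodule.map_span,
      Submodule.span_le]
    rintro _ ⟨_, ⟨x, rfl⟩, rfl⟩
    rw [← chainVec_coe v, Module.End.mul_apply, hv.pow_apply_chainVec]
    by_cases h : x.1 ≤ x.2.2 + m
    · rw [chainVec_of_le v h, map_zero]
      exact zero_mem _
    · have := hspan ⟨x.1, x.2.1, ⟨x.2.2 + m, by omega⟩⟩ (by simp [hH])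
      rwa [← chainVec_coe v] at this
  have := Set.ncard_sdiff_add_ncard_of_subset hSH
  have : powRank c m = H.ncard := rfl
  omega

end IsJordanBasis

open Classical in
/-- The endomorphism that shifts the blocks of each size cyclically, and links the cycles of
the sizes `i - 1` and `i` for `i` in `R`. -/
noncomputable def burgeEnd (v : Module.Basis (JordanIndex c) F V) (R : Set ℕ) : Module.End F V :=
  v.constr F fun x =>
    if (x.2.1 : ℕ) + 1 < c x.1 then chainVec v x.1 (x.2.1 + 1) x.2.2
    else if x.1 ∈ R then
      -- The value `c 0` is arbitrary and carries no basis vectors, so size 1 is treated as having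
      -- no smaller neighbour.
      if c (x.1 - 1) = 0 ∨ x.1 = 1 then chainVec v x.1 0 (x.2.2 + 1)
      else chainVec v (x.1 - 1) 0 x.2.2
    else chainVec v (x.1 + 1) 0 (x.2.2 + 1)

open Classical in
theorem burgeEnd_chainVec (v : Module.Basis (JordanIndex c) F V) (R : Set ℕ) {i k : ℕ}
    (hk : k < c i) (h : ℕ) : burgeEnd v R (chainVec v i k h) =
    if k + 1 < c i then chainVec v i (k + 1) h
    else if i ∈ R then
      if c (i - 1) = 0 ∨ i = 1 then chainVec v i 0 (h + 1) else chainVec v (i - 1) 0 h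
    else chainVec v (i + 1) 0 (h + 1) := by
  by_cases H : h < i
  · rw [burgeEnd, show chainVec v i k h = v ⟨i, ⟨k, hk⟩, ⟨h, H⟩⟩ from
      chainVec_coe v ⟨i, ⟨k, hk⟩, ⟨h, H⟩⟩, v.constr_basis]
  · rw [chainVec_of_le v (by omega), map_zero]
    split_ifs <;> rw [chainVec_of_le v (by omega)]

theorem isTriangular_burgeEnd (hv : IsJordanBasis v b) : IsTriangular v b (burgeEnd v R) := by
  constructor
  · refine v.ext fun x => ?_
    rw [Module.End.mul_apply, Module.End.mul_apply, ← chainVec_coe v, hv.apply_chainVec,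
      burgeEnd_chainVec v R x.2.1.2, burgeEnd_chainVec v R x.2.1.2]
    split_ifs <;> rw [hv.apply_chainVec]
  · intro i k l h hne
    have hh := h.2
    rw [← chainVec_coe v, burgeEnd_chainVec v R k.2] at hne
    split_ifs at hne <;>
      · rw [repr_chainVec] at hne
        simp only [ne_eq, ite_eq_right_iff, one_ne_zero, imp_false, not_not] at hne
        rw [Fin.lt_def]
        omega

/-- Every basis vector in the range of `b ^ m`, except at position `m` of the first block of a size
in `R`, is the image of a basis vector in that range. The position rises only on entering the first
block of a size in `R`. -/
theorem IsJordanBasis.le_finrank_range_pow_mul_burgeEnd (hv : IsJordanBasis v b) [Module.Finite F V]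
    (hR : IsBurgeSet c R) (m : ℕ) :
    powRank c m ≤
      Module.finrank F (LinearMap.range (b ^ m * burgeEnd v R)) + countAbove R m := by
  classical
  have := Module.Finite.finite_basis v
  set H : Set (JordanIndex c) := {x | m ≤ (x.2.2 : ℕ)} with hH
  let S : Set (JordanIndex c) := {x | x.1 ∈ R ∧ (x.2.1 : ℕ) = 0 ∧ (x.2.2 : ℕ) = m}
  have hSH : S ⊆ H := fun x hx => hx.2.2.ge
  have hS : S.ncard ≤ countAbove R m := by
    refine Set.ncard_le_ncard_of_injOn Sigma.fst ?_ ?_ (hR.finite.subset fun _ h => h.1)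
    · rintro ⟨i, k, h⟩ ⟨h1, -, h3⟩
      exact ⟨h1, h3 ▸ h.2⟩
    · rintro ⟨i, k, h⟩ ⟨h1, h2, h3⟩ ⟨i', k', h'⟩ ⟨h1', h2', h3'⟩ (rfl : i = i')
      obtain rfl : k = k' := Fin.ext (h2.trans h2'.symm)
      obtain rfl : h = h' := Fin.ext (h3.trans h3'.symm)
      rfl
  have hle : (H \ S).ncard ≤ Module.finrank F (LinearMap.range (b ^ m * burgeEnd v R)) := by
    refine ncard_le_finrank_span v _ _ ?_
    rw [← ((isTriangular_burgeEnd hv).1.pow_right m).eq]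
    have key : ∀ x ∈ H \ S, ∃ i k h, k < c i ∧
        burgeEnd v R (chainVec v i k (h + m)) = chainVec v x.1 x.2.1 x.2.2 := by
      rintro ⟨i, k, h⟩ ⟨hx, hxS⟩
      have hxm : m ≤ h := hx
      have hh := h.2
      have hk := k.2
      dsimp only at hh hk ⊢
      by_cases hk0 : (k : ℕ) = 0
      · by_cases hi : i ∈ R
        · have hmh : m < h := lt_of_le_of_ne hxm fun he => hxS ⟨hi, hk0, he.symm⟩
          by_cases hc : c (i - 1) = 0 ∨ i = 1
          · refine ⟨i, c i - 1, h - 1 - m, by omega, ?_⟩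
            rw [burgeEnd_chainVec v R (by omega), if_neg (by omega), if_pos hi, if_pos hc, hk0]
            congr 1
            omega
          · have hi' : i - 1 ∉ R := fun h' => hR.succ_notMem h' (by
              rwa [Nat.sub_add_cancel (hR.pos hi)])
            refine ⟨i - 1, c (i - 1) - 1, h - 1 - m, by omega, ?_⟩
            rw [burgeEnd_chainVec v R (by omega), if_neg (by omega), if_neg hi', hk0]
            congr 1 <;> omega
        · have hi' := (hR.mem_or (by omega : 1 ≤ i) (by omega)).resolve_left hi
          have hc' := hR.ne_zero hi'
          refine ⟨i + 1, c (i + 1) - 1, h - m, by omega, ?_⟩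
          rw [burgeEnd_chainVec v R (by omega), if_neg (by omega), if_pos hi',
            if_neg (by simp; omega), hk0]
          congr 1
          omega
      · refine ⟨i, k - 1, h - m, by omega, ?_⟩
        rw [burgeEnd_chainVec v R (by omega), if_pos (by omega)]
        congr 1 <;> omega
    intro x hx
    obtain ⟨i, k, h, -, he⟩ := key x hx
    refine ⟨chainVec v i k h, ?_⟩
    rw [Module.End.mul_apply, hv.pow_apply_chainVec, he, chainVec_coe]
  have := Set.ncard_sdiff_add_ncard_of_subset hSH
  have : powRank c m = H.ncard := rfl
  omega

end Ranks

/-! ### Existence and uniqueness of the Jordan type of a nilpotent endomorphism -/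

theorem countAbove_eq {R : Set ℕ} (hR : R.Finite) (m : ℕ) [Decidable (m + 1 ∈ R)] :
    countAbove R m = countAbove R (m + 1) + if m + 1 ∈ R then 1 else 0 := by
  unfold countAbove
  split_ifs with h
  · rw [← Set.ncard_insert_of_notMem (a := m + 1) (by simp) (hR.subset fun _ h => h.1)]
    congr 1
    ext j
    simp only [Set.mem_ofPred_eq, Set.mem_insert_iff]
    constructor
    · rintro ⟨h1, h2⟩
      rcases Nat.lt_or_ge (m + 1) j with h3 | h3
      · exact Or.inr ⟨h1, h3⟩
      · exact Or.inl (by omega)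
    · rintro (rfl | ⟨h1, h2⟩)
      · exact ⟨h, by omega⟩
      · exact ⟨h1, by omega⟩
  · rw [add_zero]
    congr 1
    ext j
    simp only [Set.mem_ofPred_eq]
    refine and_congr_right fun hj => ⟨fun h1 => lt_of_le_of_ne h1 ?_, fun h1 => by omega⟩
    rintro rfl
    exact h hj

/-- First differences count the blocks of size greater than `m`; second differences count those of
size exactly `m + 1`. -/
theorem powRank_second_difference (c : ℕ → ℕ) [Finite (JordanIndex c)] (m : ℕ) :
    c (m + 1) + 2 * powRank c (m + 1) = powRank c m + powRank c (m + 2) := by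
  let E : ℕ → Set (JordanIndex c) := fun m => {x | (x.2.2 : ℕ) = m}
  have h1 : ∀ m, powRank c m = powRank c (m + 1) + (E m).ncard := by
    intro m
    unfold powRank
    rw [← Set.ncard_union_eq]
    · congr 1
      ext x
      simp only [E, Set.mem_ofPred_eq, Set.mem_union]
      omega
    · rw [Set.disjoint_left]
      intro x hx hx'
      simp only [E, Set.mem_ofPred_eq] at hx hx'
      omega
  have h2 : (E m).ncard = (E (m + 1)).ncard + c (m + 1) := by
    let g : Fin (c (m + 1)) → JordanIndex c := fun k => ⟨m + 1, k, Fin.last m⟩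
    have hg : Function.Injective g := fun k k' h => by simpa [g] using h
    have hg' : (Set.range g).ncard = c (m + 1) := by
      rw [← Set.image_univ, Set.ncard_image_of_injective _ hg, Set.ncard_univ, Nat.card_fin]
    -- Moving one position back embeds level `m + 1` into level `m` and misses only the last
    -- positions of blocks of size `m + 1`.
    let s : JordanIndex c → JordanIndex c := fun x =>
      ⟨x.1, x.2.1, ⟨x.2.2 - 1, by have := x.2.2.2; omega⟩⟩
    have hs : (s '' E (m + 1)).ncard = (E (m + 1)).ncard := by
      refine Set.InjOn.ncard_image ?_
      rintro ⟨i, k, h⟩ (hx : (h : ℕ) = m + 1) ⟨i', k', h'⟩ (hx' : (h' : ℕ) = m + 1) heq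
      obtain ⟨rfl, h3⟩ := Sigma.mk.inj_iff.1 heq
      obtain ⟨rfl, -⟩ := Prod.mk_inj.1 (eq_of_heq h3)
      obtain rfl : h = h' := Fin.ext (hx.trans hx'.symm)
      rfl
    rw [← hs, ← hg', ← Set.ncard_union_eq]
    · congr 1
      ext ⟨i, k, h⟩
      constructor
      · rintro (hx : (h : ℕ) = m)
        have hh := h.2
        by_cases hi : i = m + 1
        · subst hi
          exact Or.inr ⟨k, by rw [show h = Fin.last m from Fin.ext hx]⟩
        · refine Or.inl ⟨⟨i, k, ⟨m + 1, by omega⟩⟩, rfl, ?_⟩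
          simp [s, ← hx]
      · rintro (⟨x, hx, he⟩ | ⟨l, hl⟩)
        · rw [← he]
          have : (x.2.2 : ℕ) = m + 1 := hx
          simp [E, s, this]
        · rw [← hl]
          simp [E, g]
    · rw [Set.disjoint_left]
      rintro _ ⟨x, hx, rfl⟩ ⟨k, hk⟩
      have h3 : (x.2.2 : ℕ) = m + 1 := hx
      have h4 := x.2.2.2
      have h5 : m + 1 = x.1 := congrArg Sigma.fst hk
      omega
  have h3 := h1 m
  have h4 : powRank c (m + 1) = powRank c (m + 2) + _ := h1 (m + 1)
  omega

section Existence

variable {F V : Type*} [Field F] [AddCommGroup V] [Module F V]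

theorem IsJordanBasis.of_eq {c c' : ℕ → ℕ} (hc : ∀ i, 0 < i → c i = c' i)
    {v : Module.Basis (JordanIndex c) F V} {b : Module.End F V} (hv : IsJordanBasis v b) :
    ∃ v' : Module.Basis (JordanIndex c') F V, IsJordanBasis v' b := by
  let e : JordanIndex c ≃ JordanIndex c' :=
    { toFun := fun x => ⟨x.1, Fin.cast (hc _ x.2.2.pos) x.2.1, x.2.2⟩
      invFun := fun x => ⟨x.1, Fin.cast (hc _ x.2.2.pos).symm x.2.1, x.2.2⟩
      left_inv := fun x => rfl
      right_inv := fun x => rfl }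
  refine ⟨v.reindex e, fun i k h => ?_⟩
  simp only [Module.Basis.reindex_apply]
  exact hv i (Fin.cast (hc _ h.pos).symm k) h

theorem isJordanBasis_of_sigma {d : ℕ} {k : Fin d → ℕ} {b : Module.End F V}
    (w : Module.Basis (Σ j : Fin d, Fin (k j)) F V)
    (hw : ∀ (j : Fin d) (h : Fin (k j)),
      b (w ⟨j, h⟩) = if hh : (h : ℕ) + 1 < k j then w ⟨j, ⟨h + 1, hh⟩⟩ else 0) :
    ∃ (c : ℕ → ℕ) (v : Module.Basis (JordanIndex c) F V), IsJordanBasis v b := by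
  let φ : ∀ i, {j // k j = i} ≃ Fin (Nat.card {j // k j = i}) := fun i => Finite.equivFin _
  let e : (Σ j : Fin d, Fin (k j)) ≃ JordanIndex fun i => Nat.card {j // k j = i} :=
    { toFun := fun x => ⟨k x.1, φ _ ⟨x.1, rfl⟩, x.2⟩
      invFun := fun x => ⟨((φ _).symm x.2.1).1, Fin.cast ((φ _).symm x.2.1).2.symm x.2.2⟩
      left_inv := by
        rintro ⟨j, h⟩
        have key : ∀ y : {j' // k j' = k j}, y = ⟨j, rfl⟩ →
            (⟨y.1, Fin.cast y.2.symm h⟩ : Σ j : Fin d, Fin (k j)) = ⟨j, h⟩ := by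
          rintro _ rfl
          rfl
        exact key _ ((φ (k j)).symm_apply_apply _)
      right_inv := by
        rintro ⟨i, l, h⟩
        have key : ∀ y : {j // k j = i}, (⟨k y.1, φ _ ⟨y.1, rfl⟩, Fin.cast y.2.symm h⟩ :
            JordanIndex fun i => Nat.card {j // k j = i}) = ⟨i, φ i y, h⟩ := by
          rintro ⟨j, rfl⟩
          rfl
        have := key ((φ i).symm l)
        rwa [(φ i).apply_symm_apply] at this }
  refine ⟨_, w.reindex e, ?_⟩
  intro i l h
  obtain ⟨⟨j, rfl⟩, rfl⟩ := (φ i).surjective l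
  have he : ∀ h : Fin (k j), e.symm ⟨k j, φ _ ⟨j, rfl⟩, h⟩ = ⟨j, h⟩ := fun h =>
    e.symm_apply_eq.2 rfl
  simp only [Module.Basis.reindex_apply]
  rw [he, hw]
  split_ifs
  · rw [he]
  · rfl

open Polynomial in
theorem exists_basis_quotient_X_pow (F : Type*) [Field F] (k : ℕ) :
    ∃ w : Module.Basis (Fin k) F (F[X] ⧸ Submodule.span F[X] {(X : F[X]) ^ k}),
      ∀ h : Fin k, (X : F[X]) • w h = if hh : (h : ℕ) + 1 < k then w ⟨h + 1, hh⟩ else 0 := by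
  have hm : (X ^ k : F[X]).Monic := monic_X_pow k
  let p := AdjoinRoot.powerBasis' hm
  have hdim : p.dim = k := by
    simp [p, AdjoinRoot.powerBasis'_dim]
  let w : Module.Basis (Fin k) F (AdjoinRoot (X ^ k : F[X])) :=
    p.basis.reindex (finCongr hdim)
  have hw : ∀ h : Fin k, w h = AdjoinRoot.mk (X ^ k : F[X]) (X ^ (h : ℕ)) := by
    intro h
    simp [w, p, AdjoinRoot.powerBasis'_gen]
  let w' : Module.Basis (Fin k) F (F[X] ⧸ Submodule.span F[X] {(X : F[X]) ^ k}) := w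
  have hw' : ∀ h : Fin k, w' h = Submodule.Quotient.mk (X ^ (h : ℕ)) := hw
  refine ⟨w', fun h => ?_⟩
  rw [hw', ← Submodule.Quotient.mk_smul, smul_eq_mul, ← pow_succ']
  split_ifs with hh
  · rw [hw']
  · rw [Submodule.Quotient.mk_eq_zero]
    exact Ideal.mem_span_singleton.2 (pow_dvd_pow _ (by omega))

theorem dfinsuppBasis_apply {ι : Type*} [DecidableEq ι] {M : ι → Type*} {η : ι → Type*}
    [∀ i, AddCommGroup (M i)] [∀ i, Module F (M i)] (w : ∀ i, Module.Basis (η i) F (M i))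
    (i : ι) (x : η i) : DFinsupp.basis w ⟨i, x⟩ = DFinsupp.single i (w i x) := by
  classical
  rw [Module.Basis.apply_eq_iff]
  ext ⟨j, y⟩
  change (w j).repr (DFinsupp.single i (w i x) j) y = _
  by_cases hj : i = j
  · subst hj
    simp [Finsupp.single_apply]
  · rw [DFinsupp.single_eq_of_ne (Ne.symm hj), Finsupp.single_eq_of_ne]
    · simp
    · rintro h
      exact hj (congrArg Sigma.fst h).symm

open Polynomial DirectSum in
-- With `X` acting as `b`, the space is an `X`-power torsion module over `F[X]`, hence a direct sum
-- of modules `F[X] / (X ^ k)`, whose monomial bases are Jordan chains.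
theorem exists_isJordanBasis [Module.Finite F V] {b : Module.End F V} (hb : IsNilpotent b) :
    ∃ (c : ℕ → ℕ) (v : Module.Basis (JordanIndex c) F V), IsJordanBasis v b := by
  classical
  have htors : Module.IsTorsion' (Module.AEval' b) (Submonoid.powers (X : F[X])) := by
    obtain ⟨N, hN⟩ := hb
    intro x
    refine ⟨⟨X ^ N, pow_mem (Submonoid.mem_powers _) N⟩, ?_⟩
    obtain ⟨x, rfl⟩ := (Module.AEval'.of b).surjective x
    rw [Submonoid.mk_smul, Module.AEval'.X_pow_smul_of, hN, zero_smul, map_zero]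
  obtain ⟨d, k, ⟨e⟩⟩ := Module.torsion_by_prime_power_decomposition irreducible_X htors
  choose w hw using fun j => exists_basis_quotient_X_pow F (k j)
  let e' : V ≃ₗ[F] (⨁ j : Fin d, F[X] ⧸ Submodule.span F[X] {(X : F[X]) ^ k j}) :=
    (Module.AEval'.of b).trans (e.restrictScalars F)
  have he' : ∀ x, e' (b x) = (X : F[X]) • e' x := by
    intro x
    change e (Module.AEval'.of b (b x)) = X • e (Module.AEval'.of b x)
    rw [← map_smul, Module.AEval'.X_smul_of]
  let u : Module.Basis (Σ j : Fin d, Fin (k j)) F V := (DFinsupp.basis w).map e'.symm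
  have hu : ∀ j h, e' (u ⟨j, h⟩) = DirectSum.of _ j (w j h) := by
    intro j h
    simp only [u, Module.Basis.map_apply, LinearEquiv.apply_symm_apply]
    exact dfinsuppBasis_apply w j h
  refine isJordanBasis_of_sigma u fun j h => e'.injective ?_
  rw [he', hu, ← DirectSum.lof_eq_of F[X], ← map_smul, hw]
  split_ifs with hh
  · rw [hu]; rfl
  · simp

theorem IsJordanBasis.eq_of_finrank {c c' : ℕ → ℕ} [Module.Finite F V]
    {v : Module.Basis (JordanIndex c) F V} {b : Module.End F V} (hv : IsJordanBasis v b)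
    (h : ∀ m, c' (m + 1) + 2 * Module.finrank F (LinearMap.range (b ^ (m + 1))) =
      Module.finrank F (LinearMap.range (b ^ m)) +
        Module.finrank F (LinearMap.range (b ^ (m + 2)))) (i : ℕ) (hi : 0 < i) : c i = c' i := by
  have := Module.Finite.finite_basis v
  obtain ⟨m, rfl⟩ : ∃ m, i = m + 1 := ⟨i - 1, by omega⟩
  have h1 := h m
  simp only [hv.finrank_range_pow] at h1
  have h2 := powRank_second_difference c m
  omega

theorem hasJordanType_of_finrank [Module.Finite F V] {b : Module.End F V} (hb : IsNilpotent b)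
    {m : ℕ} (P : m.Partition)
    (h : ∀ m, P.parts.count (m + 1) + 2 * Module.finrank F (LinearMap.range (b ^ (m + 1))) =
      Module.finrank F (LinearMap.range (b ^ m)) +
        Module.finrank F (LinearMap.range (b ^ (m + 2)))) : HasJordanType b P := by
  obtain ⟨c, v, hv⟩ := exists_isJordanBasis hb
  exact hv.of_eq (hv.eq_of_finrank (c' := fun i => P.parts.count i) h)

end Existence

/-- Stated additively, so that no truncated subtraction remains. -/
theorem count_burgePartition {n : ℕ} (P : n.Partition)
    [DecidablePred (· ∈ burgeR (Multiset.toFinsupp P.parts))] (m : ℕ) :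
    (burgePartition P).parts.count (m + 1) +
      (if m + 1 ∈ burgeR (Multiset.toFinsupp P.parts) then 1 else 0) = P.parts.count (m + 1) +
      if m + 2 ∈ burgeR (Multiset.toFinsupp P.parts) then 1 else 0 := by
  have h1 : (burgePartition P).parts.count (m + 1) =
      burgeFreq (Multiset.toFinsupp P.parts) (m + 1) := by
    simp only [burgePartition, Nat.Partition.ofMultiset, Nat.Partition.ofSums]
    rw [Multiset.count_filter_of_pos (p := fun x => x ≠ 0) (Nat.succ_ne_zero m),
      Finsupp.count_toMultiset]
  have h2 : m + 1 ∈ burgeR (Multiset.toFinsupp P.parts) → P.parts.count (m + 1) ≠ 0 := fun h =>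
    ne_zero_of_mem_burgeR h
  rw [h1, burgeFreq, Finsupp.onFinset_apply, if_neg (Nat.succ_ne_zero m), Multiset.toFinsupp_apply]
  by_cases h3 : m + 1 ∈ burgeR (Multiset.toFinsupp P.parts) <;>
  by_cases h4 : m + 2 ∈ burgeR (Multiset.toFinsupp P.parts) <;>
  simp [h3, h4] 
  have := h2 h3
  omega

/-! ### From ranks to the Jordan type of the restriction -/

section Restriction

variable {F V : Type*} [Field F] [AddCommGroup V] [Module F V] [Module.Finite F V]

/-- The restriction of `b` to the range of a commuting endomorphism `a` has Jordan type `∂P` if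
the ranks of all `b ^ m * a` are those prescribed by `∂P`. -/
theorem restrictionHasJordanType_of_finrank {n : ℕ} {P : n.Partition} {a b : Module.End F V}
    [Finite (JordanIndex fun i => P.parts.count i)] (hb : IsNilpotent b) (hab : Commute a b)
    (h : ∀ m, Module.finrank F (LinearMap.range (b ^ m * a)) +
      countAbove (burgeR (Multiset.toFinsupp P.parts)) m = powRank (fun i => P.parts.count i) m) :
    RestrictionHasJordanType b (LinearMap.range a) (burgePartition P) := by
  classical
  have hW : ∀ x ∈ LinearMap.range a, b x ∈ LinearMap.range a := by
    rintro _ ⟨x, rfl⟩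
    exact ⟨b x, LinearMap.congr_fun hab.eq x⟩
  have hpow : ∀ m (x : LinearMap.range a), (((b.restrict hW) ^ m) x : V) = (b ^ m) x := by
    intro m x
    induction m with
    | zero => rfl
    | succ m ih => rw [pow_succ', pow_succ', Module.End.mul_apply, Module.End.mul_apply, ← ih]; rfl
  have hrank : ∀ m, Module.finrank F (LinearMap.range ((b.restrict hW) ^ m)) =
      Module.finrank F (LinearMap.range (b ^ m * a)) := by
    intro m
    have h1 : LinearMap.range (b ^ m * a) =
        (LinearMap.range ((b.restrict hW) ^ m)).map (LinearMap.range a).subtype := by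
      ext y
      constructor
      · rintro ⟨x, rfl⟩
        exact ⟨_, ⟨⟨a x, x, rfl⟩, rfl⟩, hpow m _⟩
      · rintro ⟨_, ⟨⟨_, ⟨x, rfl⟩⟩, rfl⟩, rfl⟩
        exact ⟨x, (hpow m ⟨a x, x, rfl⟩).symm⟩
    rw [h1]
    exact (Submodule.equivMapOfInjective _ (Submodule.injective_subtype _) _).finrank_eq
  refine ⟨hW, hasJordanType_of_finrank ?_ _ fun m => ?_⟩
  · obtain ⟨N, hN⟩ := hb
    refine ⟨N, LinearMap.ext fun x => Subtype.ext ?_⟩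
    rw [hpow, hN]
    rfl
  · have hfin : (burgeR (Multiset.toFinsupp P.parts)).Finite := by
      have : Finite (JordanIndex (Multiset.toFinsupp P.parts)) :=
        ‹Finite (JordanIndex fun i => P.parts.count i)›
      exact (isBurgeSet_burgeR (Multiset.toFinsupp P.parts)).finite
    have h1 := count_burgePartition P m
    have h2 := powRank_second_difference (fun i => P.parts.count i) m
    have h3 := countAbove_eq hfin m
    have h4 := countAbove_eq hfin (m + 1)
    rw [hrank, hrank, hrank]
    have h5 := h m
    have h6 := h (m + 1)
    have h7 := h (m + 2)
    simp only [add_assoc, Nat.reduceAdd] at *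
    omega

end Restriction

/-! ### Jordan bases adapted to a commuting nilpotent endomorphism -/

section Triangularization

variable {F : Type*} [Field F]

/-- A nilpotent map is not onto, so its range lies in a hyperplane `ker φ`. Induction applies on the
hyperplane, and a vector outside it is placed first. -/
theorem exists_basis_strictly_triangular {d : ℕ} {W : Type*} [AddCommGroup W] [Module F W]
    [Module.Finite F W] (hd : Module.finrank F W = d) (N : Module.End F W) (hN : IsNilpotent N) :
    ∃ b : Module.Basis (Fin d) F W, ∀ k l, b.repr (N (b k)) l ≠ 0 → k < l := by
  induction d generalizing W with
  | zero => exact ⟨Module.finBasisOfFinrankEq F W hd, fun k => k.elim0⟩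
  | succ d ih =>
    have hlt : LinearMap.range N < ⊤ := by
      rw [lt_top_iff_ne_top, Ne, LinearMap.range_eq_top]
      intro hsurj
      obtain ⟨n, hn⟩ := hN
      have h1 : Function.Surjective (N ^ n) := by
        rw [Module.End.coe_pow]
        exact hsurj.iterate n
      have : Subsingleton W := by
        refine subsingleton_of_forall_eq 0 fun y => ?_
        obtain ⟨x, rfl⟩ := h1 y
        rw [hn, LinearMap.zero_apply]
      have := Module.finrank_zero_of_subsingleton (R := F) (M := W)
      omega
    obtain ⟨φ, hφ, hle⟩ := Submodule.exists_le_ker_of_lt_top _ hlt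
    have hφs : Function.Surjective φ := LinearMap.surjective hφ
    have hker : Module.finrank F (LinearMap.ker φ) = d := by
      have h1 := LinearMap.finrank_range_add_finrank_ker φ
      rw [LinearMap.range_eq_top.2 hφs, finrank_top, Module.finrank_self] at h1
      omega
    have hmem : ∀ x, N x ∈ LinearMap.ker φ := fun x => hle ⟨x, rfl⟩
    obtain ⟨b', hb'⟩ := ih hker (N.restrict (fun x _ => hmem x))
      (Module.End.isNilpotent.restrict _ hN)
    obtain ⟨y, hy⟩ := hφs 1
    let b : Module.Basis (Fin (d + 1)) F W := Module.Basis.mkFinCons y b'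
      (fun s x hx h => by
        have := congrArg φ h
        simpa [hy, LinearMap.mem_ker.1 hx] using this)
      (fun z => ⟨-φ z, by simp [hy]⟩)
    have hbs : ∀ k : Fin d, b k.succ = b' k := fun k => by simp [b]
    have h0 : b.coord 0 ∘ₗ (LinearMap.ker φ).subtype = 0 := by
      refine b'.ext fun k => ?_
      rw [LinearMap.comp_apply, Submodule.subtype_apply, ← hbs, b.coord_apply, b.repr_self,
        Finsupp.single_eq_of_ne (Fin.succ_ne_zero k).symm]
      rfl
    have hs : ∀ l : Fin d, b.coord l.succ ∘ₗ (LinearMap.ker φ).subtype = b'.coord l := by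
      refine fun l => b'.ext fun k => ?_
      rw [LinearMap.comp_apply, Submodule.subtype_apply, ← hbs, b.coord_apply, b.repr_self,
        b'.coord_apply, b'.repr_self, Finsupp.single_apply, Finsupp.single_apply]
      simp
    refine ⟨b, fun k l hne => ?_⟩
    have hNk := hmem (b k)
    induction l using Fin.cases with
    | zero => exact absurd (LinearMap.congr_fun h0 ⟨_, hNk⟩) hne
    | succ l =>
      induction k using Fin.cases with
      | zero => exact Fin.succ_pos l
      | succ k =>
        have h1 : b'.repr ⟨_, hNk⟩ l ≠ 0 := by
          rw [← b'.coord_apply, ← hs]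
          exact hne
        refine Fin.succ_lt_succ_iff.2 (hb' k l ?_)
        have h2 : (N.restrict (fun x _ => hmem x)) (b' k) =
            (⟨N (b k.succ), hNk⟩ : LinearMap.ker φ) := by
          exact Subtype.ext (congrArg N (hbs k).symm)
        rwa [h2]

theorem exists_conj_strictly_triangular {d : ℕ} (M : Matrix (Fin d) (Fin d) F)
    (hM : IsNilpotent M) : ∃ G H : Matrix (Fin d) (Fin d) F, G * H = 1 ∧ H * G = 1 ∧
      ∀ k l, (H * M * G) l k ≠ 0 → k < l := by
  obtain ⟨b, hb⟩ := exists_basis_strictly_triangular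
    (Module.finrank_fin_fun F (n := d)) (Matrix.toLin' M)
    (hM.map Matrix.toLinAlgEquiv')
  let e := Pi.basisFun F (Fin d)
  refine ⟨e.toMatrix b, b.toMatrix e, e.toMatrix_mul_toMatrix_flip b,
    b.toMatrix_mul_toMatrix_flip e, fun k l hne => hb k l ?_⟩
  have h1 : b.toMatrix e * M * e.toMatrix b = LinearMap.toMatrix b b (Matrix.toLin' M) := by
    have h2 : LinearMap.toMatrix e e (Matrix.toLin' M) = M := by
      rw [LinearMap.toMatrix_eq_toMatrix', LinearMap.toMatrix'_toLin']
    have h3 := basis_toMatrix_mul_linearMap_toMatrix_mul_basis_toMatrix b e b e (Matrix.toLin' M)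
    rwa [h2] at h3
  rwa [h1, LinearMap.toMatrix_apply] at hne

end Triangularization

/-! ### Diagonal blocks of the centralizer and change of Jordan basis -/

section Adapted

variable {F V : Type*} [Field F] [AddCommGroup V] [Module F V] {c : ℕ → ℕ}

/-- The matrix of coefficients of `a` between the vectors at position `h` in the blocks of
size `i`. -/
noncomputable def blockMatrix (v : Module.Basis (JordanIndex c) F V) (a : Module.End F V) (i : ℕ)
    (h : Fin i) : Matrix (Fin (c i)) (Fin (c i)) F :=
  Matrix.of fun l k => v.repr (a (v ⟨i, k, h⟩)) ⟨i, l, h⟩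

/-- The endomorphism acting by the matrices `G i` on the blocks of size `i`. -/
noncomputable def blockEnd (v : Module.Basis (JordanIndex c) F V)
    (G : ∀ i, Matrix (Fin (c i)) (Fin (c i)) F) : Module.End F V :=
  v.constr F fun x => ∑ l, G x.1 l x.2.1 • v ⟨x.1, l, x.2.2⟩

theorem blockEnd_apply (v : Module.Basis (JordanIndex c) F V)
    (G : ∀ i, Matrix (Fin (c i)) (Fin (c i)) F) (i : ℕ) (k : Fin (c i)) (h : Fin i) :
    blockEnd v G (v ⟨i, k, h⟩) = ∑ l, G i l k • v ⟨i, l, h⟩ := by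
  rw [blockEnd, v.constr_basis]

theorem blockEnd_mul (v : Module.Basis (JordanIndex c) F V)
    (G H : ∀ i, Matrix (Fin (c i)) (Fin (c i)) F) :
    blockEnd v G * blockEnd v H = blockEnd v fun i => G i * H i := by
  refine v.ext fun ⟨i, k, h⟩ => ?_
  simp only [Module.End.mul_apply, blockEnd_apply, map_sum, map_smul, Matrix.mul_apply,
    Finset.smul_sum, Finset.sum_smul, smul_smul]
  rw [Finset.sum_comm]
  exact Finset.sum_congr rfl fun _ _ => Finset.sum_congr rfl fun _ _ => by rw [mul_comm]

theorem blockEnd_one (v : Module.Basis (JordanIndex c) F V) :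
    blockEnd v (fun _ => 1) = 1 := by
  refine v.ext fun ⟨i, k, h⟩ => ?_
  simp [blockEnd_apply, Matrix.one_apply]

theorem blockMatrix_blockEnd (v : Module.Basis (JordanIndex c) F V)
    (G : ∀ i, Matrix (Fin (c i)) (Fin (c i)) F) (i : ℕ) (h : Fin i) :
    blockMatrix v (blockEnd v G) i h = G i := by
  ext l k
  simp [blockMatrix, blockEnd_apply, Finsupp.single_apply]

namespace IsJordanBasis

variable {v : Module.Basis (JordanIndex c) F V} {b : Module.End F V}

theorem commute_blockEnd (hv : IsJordanBasis v b) (G : ∀ i, Matrix (Fin (c i)) (Fin (c i)) F) :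
    Commute (blockEnd v G) b := by
  refine v.ext fun ⟨i, k, h⟩ => ?_
  rw [Module.End.mul_apply, Module.End.mul_apply, hv, blockEnd_apply, map_sum]
  simp only [map_smul, hv i _ h]
  split_ifs
  · rw [blockEnd_apply]
  · simp

/-- An intermediate index contributing to the product satisfies the inequalities of
`repr_apply_ne_zero` in both directions, so it has the same size and position. -/
theorem blockMatrix_mul (hv : IsJordanBasis v b) [Module.Finite F V] {a a' : Module.End F V}
    (ha : Commute a b) (ha' : Commute a' b) (i : ℕ) (h : Fin i) :
    blockMatrix v (a * a') i h = blockMatrix v a i h * blockMatrix v a' i h := by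
  have := Module.Finite.finite_basis v
  have : Fintype (JordanIndex c) := Fintype.ofFinite _
  ext l k
  have h1 : v.repr ((a * a') (v ⟨i, k, h⟩)) ⟨i, l, h⟩ =
      ∑ z, v.repr (a' (v ⟨i, k, h⟩)) z * v.repr (a (v z)) ⟨i, l, h⟩ := by
    rw [Module.End.mul_apply]
    conv_lhs => rw [← v.sum_repr (a' (v ⟨i, k, h⟩))]
    simp only [map_sum, map_smul, Finsupp.coe_finsetSum, Finset.sum_apply, Finsupp.smul_apply,
      smul_eq_mul]
  rw [Matrix.mul_apply]
  refine h1.trans ?_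
  symm
  refine Finset.sum_of_injOn (fun j => (⟨i, j, h⟩ : JordanIndex c)) ?_ ?_ ?_ ?_
  · intro j _ j' _ hj
    simpa using hj
  · intro j _
    simp
  · rintro ⟨i', k', h'⟩ - hz
    by_contra hne
    obtain ⟨h2, h3⟩ := hv.repr_apply_ne_zero ha' (left_ne_zero_of_mul hne)
    obtain ⟨h4, h5⟩ := hv.repr_apply_ne_zero ha (right_ne_zero_of_mul hne)
    dsimp only at h2 h3 h4 h5
    obtain rfl : i = i' := by omega
    obtain rfl : h = h' := Fin.ext (by omega)
    exact hz ⟨k', by simp, rfl⟩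
  · intro j _
    simp only [blockMatrix, Matrix.of_apply]
    rw [mul_comm]

theorem isNilpotent_blockMatrix (hv : IsJordanBasis v b) [Module.Finite F V]
    {a : Module.End F V} (ha : Commute a b) (hn : IsNilpotent a) (i : ℕ) (h : Fin i) :
    IsNilpotent (blockMatrix v a i h) := by
  have hpow : ∀ n, blockMatrix v (a ^ n) i h = blockMatrix v a i h ^ n := by
    intro n
    induction n with
    | zero =>
      rw [pow_zero, pow_zero, ← blockEnd_one v, blockMatrix_blockEnd]
    | succ n ih => rw [pow_succ, pow_succ, ← ih, hv.blockMatrix_mul (ha.pow_left n) ha]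
  obtain ⟨n, hn⟩ := hn
  refine ⟨n, ?_⟩
  rw [← hpow, hn]
  ext
  simp [blockMatrix]

/-- The diagonal blocks of `a` are nilpotent and independent of the position, so one conjugating
matrix per size suffices. The resulting `blockEnd` commutes with `b` and therefore carries Jordan
bases to Jordan bases. -/
theorem exists_isTriangular (hv : IsJordanBasis v b) [Module.Finite F V]
    {a : Module.End F V} (ha : Commute a b) (hn : IsNilpotent a) :
    ∃ v' : Module.Basis (JordanIndex c) F V, IsJordanBasis v' b ∧ IsTriangular v' b a := by
  have hG : ∀ i, ∃ G H : Matrix (Fin (c i)) (Fin (c i)) F, G * H = 1 ∧ H * G = 1 ∧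
      ∀ (h : Fin i) k l, (H * blockMatrix v a i h * G) l k ≠ 0 → k < l := by
    intro i
    rcases Nat.eq_zero_or_pos i with rfl | hi
    · exact ⟨1, 1, by simp, by simp, fun h => h.elim0⟩
    · obtain ⟨G, H, h1, h2, h3⟩ := exists_conj_strictly_triangular _
        (hv.isNilpotent_blockMatrix ha hn i ⟨0, hi⟩)
      refine ⟨G, H, h1, h2, fun h => ?_⟩
      have : blockMatrix v a i h = blockMatrix v a i ⟨0, hi⟩ := by
        ext l k
        exact hv.repr_apply_diag ha k l h ⟨0, hi⟩
      rwa [this]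
  choose G H h1 h2 h3 using hG
  let e : V ≃ₗ[F] V := LinearEquiv.ofLinearMap (blockEnd v G) (blockEnd v H)
    (by
      change blockEnd v G * blockEnd v H = 1
      rw [blockEnd_mul, ← blockEnd_one v]
      simp only [h1])
    (by
      change blockEnd v H * blockEnd v G = 1
      rw [blockEnd_mul, ← blockEnd_one v]
      simp only [h2])
  have he : ∀ x, e (b x) = b (e x) := fun x => LinearMap.congr_fun (hv.commute_blockEnd G).eq x
  refine ⟨v.map e, fun i k h => ?_, ha, fun i k l h hne => h3 i h k l ?_⟩
  · simp only [Module.Basis.map_apply]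
    rw [← he, hv]
    split_ifs
    · rfl
    · exact map_zero e
  · rw [← blockMatrix_blockEnd v H i h, ← blockMatrix_blockEnd v G i h,
      ← hv.blockMatrix_mul (hv.commute_blockEnd H) ha,
      ← hv.blockMatrix_mul ((hv.commute_blockEnd H).mul_left ha) (hv.commute_blockEnd G)]
    exact hne

end IsJordanBasis
end Adapted

/-! ### Generic elements and ranks -/

section Generic

variable {F : Type*} [Field F] {n : ℕ}

/-- The restriction of a polynomial in the entries of a matrix to the line through `A` and `A'`,
as a polynomial in the parameter of the line. -/
noncomputable def restrictToLine (A A' : Matrix (Fin n) (Fin n) F)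
    (q : MvPolynomial (Fin n × Fin n) F) : Polynomial F :=
  MvPolynomial.aeval (fun ij => Polynomial.C (A ij.1 ij.2) +
    Polynomial.X * Polynomial.C (A' ij.1 ij.2 - A ij.1 ij.2)) q

theorem eval_restrictToLine (A A' : Matrix (Fin n) (Fin n) F)
    (q : MvPolynomial (Fin n × Fin n) F) (s : F) :
    (restrictToLine A A' q).eval s =
      MvPolynomial.aeval (fun ij : Fin n × Fin n => ((1 - s) • A + s • A') ij.1 ij.2) q := by
  rw [restrictToLine, ← Polynomial.coe_aeval_eq_eval, ← AlgHom.comp_apply,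
    MvPolynomial.comp_aeval]
  congr 2
  funext ij
  simp [Polynomial.coe_aeval_eq_eval]
  ring

/-- If `q` vanishes on the open set, then `q * φ` vanishes on the line from `A` to `A'`. Since `F`
is infinite, this is an identity of polynomials in the parameter; `φ` is nonzero at `A'`, so `q`
vanishes on the whole line, in particular at `A`. -/
theorem holdsGenerically_of_lines [Infinite F] {Y : Set (Matrix (Fin n) (Fin n) F)}
    {p : Matrix (Fin n) (Fin n) F → Prop} (S : Set (MvPolynomial (Fin n × Fin n) F))
    (hp : ∀ A ∈ Y, (∃ φ ∈ S, MvPolynomial.aeval (fun ij : Fin n × Fin n => A ij.1 ij.2) φ ≠ 0) →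
      p A)
    (hY : ∀ A ∈ Y, ∃ A', (∃ φ ∈ S,
      MvPolynomial.aeval (fun ij : Fin n × Fin n => A' ij.1 ij.2) φ ≠ 0) ∧
      ∀ s : F, (1 - s) • A + s • A' ∈ Y) : HoldsGenerically Y p := by
  let Z : Set (Matrix (Fin n) (Fin n) F) :=
    {A | (fun ij : Fin n × Fin n => A ij.1 ij.2) ∈ MvPolynomial.zeroLocus F (Ideal.span S)}
  have hZ : ∀ A, A ∉ Z ↔
      ∃ φ ∈ S, MvPolynomial.aeval (fun ij : Fin n × Fin n => A ij.1 ij.2) φ ≠ 0 := by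
    intro A
    simp [Z, MvPolynomial.zeroLocus_span]
  refine ⟨Y \ Z, ⟨Z, ⟨_, rfl⟩, rfl⟩, ?_, fun A hA => hp A hA.1 ((hZ A).1 hA.2)⟩
  rintro _ ⟨I, rfl⟩ hU A hA
  rw [Set.mem_ofPred_eq, MvPolynomial.mem_zeroLocus_iff]
  intro q hq
  obtain ⟨A', ⟨φ, hφ, hne⟩, hline⟩ := hY A hA
  have hmul : restrictToLine A A' q * restrictToLine A A' φ = 0 := by
    refine Polynomial.funext fun s => ?_
    rw [Polynomial.eval_mul, Polynomial.eval_zero, mul_eq_zero, or_iff_not_imp_right]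
    intro hs
    rw [eval_restrictToLine] at hs ⊢
    exact MvPolynomial.mem_zeroLocus_iff.1 (hU ⟨hline s, (hZ _).2 ⟨φ, hφ, hs⟩⟩) q hq
  have hφ0 : restrictToLine A A' φ ≠ 0 := by
    intro h0
    have := eval_restrictToLine A A' φ 1
    rw [h0] at this
    apply hne
    simpa using this.symm
  have := eval_restrictToLine A A' q 0
  rw [(mul_eq_zero.1 hmul).resolve_right hφ0] at this
  simpa using this.symm

/-- Compressing by fixed `L` and `Q` makes a lower bound on the rank a nonvanishing condition
polynomial in the entries of `M`. -/
theorem le_rank_iff_exists_det_ne_zero (M : Matrix (Fin n) (Fin n) F) (r : ℕ) :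
    r ≤ M.rank ↔ ∃ (L : Matrix (Fin r) (Fin n) F) (Q : Matrix (Fin n) (Fin r) F),
      (L * M * Q).det ≠ 0 := by
  constructor
  · intro hr
    let f := Matrix.toLin' M
    have hr' : r ≤ Module.finrank F (LinearMap.range f) := by
      rwa [Matrix.rank, ← Matrix.toLin'_apply'] at hr
    let B := Module.finBasis F (LinearMap.range f)
    have hli := B.linearIndependent.comp (Fin.castLE hr') (Fin.castLE_injective hr')
    let g : (Fin r → F) →ₗ[F] LinearMap.range f := Fintype.linearCombination F (B ∘ Fin.castLE hr')
    have hg : Function.Injective g := LinearIndependent.fintypeLinearCombination_injective hli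
    obtain ⟨s, hs⟩ := f.rangeRestrict.exists_rightInverse_of_surjective f.range_rangeRestrict
    have hfs : ∀ x, f (s x) = x := fun x => congrArg Subtype.val (LinearMap.congr_fun hs x)
    have hinj : LinearMap.ker (f ∘ₗ s ∘ₗ g) = ⊥ := by
      rw [LinearMap.ker_eq_bot]
      intro x y hxy
      simp only [LinearMap.comp_apply, hfs] at hxy
      exact hg (Subtype.ext hxy)
    obtain ⟨l, hl⟩ := LinearMap.exists_leftInverse_of_injective _ hinj
    refine ⟨LinearMap.toMatrix' l, LinearMap.toMatrix' (s ∘ₗ g), ?_⟩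
    have h1 : LinearMap.toMatrix' l * M * LinearMap.toMatrix' (s ∘ₗ g) = 1 := by
      have h2 : M = LinearMap.toMatrix' f := (LinearMap.toMatrix'_toLin' M).symm
      rw [h2, Matrix.mul_assoc, ← LinearMap.toMatrix'_comp, ← LinearMap.toMatrix'_comp, hl,
        LinearMap.toMatrix'_id]
    rw [h1, Matrix.det_one]
    exact one_ne_zero
  · rintro ⟨L, Q, hdet⟩
    have h1 := Matrix.rank_of_isUnit (L * M * Q) ((Matrix.isUnit_iff_isUnit_det _).2 hdet.isUnit)
    rw [Fintype.card_fin] at h1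
    exact h1.symm.le.trans ((Matrix.rank_mul_le_left _ _).trans (Matrix.rank_mul_le_right _ _))

/-- The determinant of `L * A * Q`, as a polynomial in the entries of `A`. -/
noncomputable def detPolynomial {r : ℕ} (L : Matrix (Fin r) (Fin n) F)
    (Q : Matrix (Fin n) (Fin r) F) : MvPolynomial (Fin n × Fin n) F :=
  (L.map (MvPolynomial.C (σ := Fin n × Fin n)) * Matrix.mvPolynomialX (Fin n) (Fin n) F *
    Q.map (MvPolynomial.C (σ := Fin n × Fin n))).det

theorem aeval_detPolynomial {r : ℕ} (L : Matrix (Fin r) (Fin n) F)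
    (Q : Matrix (Fin n) (Fin r) F) (A : Matrix (Fin n) (Fin n) F) :
    MvPolynomial.aeval (fun ij : Fin n × Fin n => A ij.1 ij.2) (detPolynomial L Q) =
      (L * A * Q).det := by
  have key : ∀ f : MvPolynomial (Fin n × Fin n) F →ₐ[F] F,
      (∀ i j, f (MvPolynomial.X (i, j)) = A i j) → f (detPolynomial L Q) = (L * A * Q).det := by
    intro f hf
    rw [detPolynomial, AlgHom.map_det]
    congr 1
    simp only [AlgHom.mapMatrix_apply, Matrix.map_mul]
    congr 2
    · ext i j
      exact f.commutes _
    · ext i j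
      exact hf i j
    · ext i j
      exact f.commutes _
  exact key _ fun i j => MvPolynomial.aeval_X _ _

end Generic

/-! ### Translation between matrices and endomorphisms -/

section Matrices

variable {F : Type*} [Field F] {n : ℕ}

theorem rank_pow_mul (A B : Matrix (Fin n) (Fin n) F) (k : ℕ) : (B ^ k * A).rank =
    Module.finrank F (LinearMap.range ((B.mulVecLin ^ k : Module.End F (Fin n → F)) *
      A.mulVecLin)) := by
  rw [Matrix.rank, Matrix.mulVecLin_mul, ← Matrix.toLin'_apply' (B ^ k), Matrix.toLin'_pow,
    Matrix.toLin'_apply']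
  rfl

theorem mem_nilpotentCommutator_iff {A B : Matrix (Fin n) (Fin n) F} :
    A ∈ nilpotentCommutator B ↔ Commute (A.mulVecLin : Module.End F (Fin n → F)) B.mulVecLin ∧
      IsNilpotent (A.mulVecLin : Module.End F (Fin n → F)) := by
  have h1 : ∀ M : Matrix (Fin n) (Fin n) F,
      (M.mulVecLin : Module.End F (Fin n → F)) = Matrix.toLinAlgEquiv' M := fun _ => rfl
  rw [h1, h1, IsNilpotent.map_iff (Matrix.toLinAlgEquiv' (R := F) (n := Fin n)).injective,
    Commute, SemiconjBy, ← map_mul, ← map_mul, Matrix.toLinAlgEquiv'.injective.eq_iff]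
  rfl

theorem exists_mem_nilpotentCommutator_isTriangular {c : ℕ → ℕ} {R : Set ℕ}
    {B : Matrix (Fin n) (Fin n) F} {v : Module.Basis (JordanIndex c) F (Fin n → F)}
    (hv : IsJordanBasis v B.mulVecLin) (hR : IsBurgeSet c R) :
    ∃ A : Matrix (Fin n) (Fin n) F, IsTriangular v B.mulVecLin A.mulVecLin ∧
      ∀ k, (B ^ k * A).rank + countAbove R k = powRank c k := by
  obtain ⟨A, hA⟩ : ∃ A : Matrix (Fin n) (Fin n) F, A.mulVecLin = burgeEnd v R :=
    ⟨LinearMap.toMatrix' (burgeEnd v R), Matrix.toLin'_toMatrix' _⟩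
  have htri : IsTriangular v B.mulVecLin A.mulVecLin := hA ▸ isTriangular_burgeEnd hv
  refine ⟨A, htri, fun k => ?_⟩
  rw [rank_pow_mul]
  refine le_antisymm (hv.finrank_range_pow_mul_le hR htri k) ?_
  rw [hA]
  exact hv.le_finrank_range_pow_mul_burgeEnd hR k

end Matrices

theorem mainTheorem3 {F : Type*} [Field F] (n : ℕ) (B : Matrix (Fin n) (Fin n) F)
    (P : n.Partition) (hB : IsNilpotent B) (hP : HasJordanType B.mulVecLin P) :
    (Infinite F →
      HoldsGenerically (nilpotentCommutator B) (fun A =>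
        RestrictionHasJordanType B.mulVecLin (LinearMap.range A.mulVecLin)
          (burgePartition P))) ∧
    ∃ A ∈ nilpotentCommutator B,
      RestrictionHasJordanType B.mulVecLin (LinearMap.range A.mulVecLin)
        (burgePartition P) := by
  classical
  obtain ⟨v, hv⟩ := hP
  change IsJordanBasis (c := fun i => P.parts.count i) v B.mulVecLin at hv
  have hfin : Finite (JordanIndex fun i => P.parts.count i) := Module.Finite.finite_basis v
  have hR : IsBurgeSet (fun i => P.parts.count i) (burgeR (Multiset.toFinsupp P.parts)) :=
    isBurgeSet_burgeR (Multiset.toFinsupp P.parts)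
  set R := burgeR (Multiset.toFinsupp P.parts)
  set c := fun i => P.parts.count i
  have hBnil : IsNilpotent (B.mulVecLin : Module.End F (Fin n → F)) :=
    hB.map Matrix.toLinAlgEquiv'
  have htype : ∀ A ∈ nilpotentCommutator B,
      (∀ k, (B ^ k * A).rank + countAbove R k = powRank c k) →
      RestrictionHasJordanType B.mulVecLin (LinearMap.range A.mulVecLin) (burgePartition P) := by
    intro A hA hrank
    refine restrictionHasJordanType_of_finrank hBnil (mem_nilpotentCommutator_iff.1 hA).1
      fun k => ?_
    rw [← rank_pow_mul]
    exact hrank k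
  have hmem : ∀ {v : Module.Basis (JordanIndex c) F (Fin n → F)}
      {A : Matrix (Fin n) (Fin n) F}, IsJordanBasis v B.mulVecLin →
      IsTriangular v B.mulVecLin A.mulVecLin → A ∈ nilpotentCommutator B := fun hv hA =>
    mem_nilpotentCommutator_iff.2 ⟨hA.1, hA.isNilpotent hv⟩
  have hadapted : ∀ A ∈ nilpotentCommutator B, ∃ v : Module.Basis (JordanIndex c) F (Fin n → F),
      IsJordanBasis v B.mulVecLin ∧ IsTriangular v B.mulVecLin A.mulVecLin := fun A hA =>
    hv.exists_isTriangular (mem_nilpotentCommutator_iff.1 hA).1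
      (mem_nilpotentCommutator_iff.1 hA).2
  constructor
  · intro hinf
    obtain ⟨N, hN⟩ := hB
    let ρ : ℕ → ℕ := fun k => powRank c k - countAbove R k
    -- A product of one determinant per exponent is nonzero exactly when all factors are, so all the
    -- rank bounds hold at once. Exponents below `N` suffice because `B ^ N = 0`.
    let S : Set (MvPolynomial (Fin n × Fin n) F) := Set.range
      fun LQ : ∀ k : Fin N, Matrix (Fin (ρ k)) (Fin n) F × Matrix (Fin n) (Fin (ρ k)) F =>
        ∏ k, detPolynomial ((LQ k).1 * B ^ (k : ℕ)) (LQ k).2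
    have hS : ∀ A : Matrix (Fin n) (Fin n) F, (∃ φ ∈ S,
        MvPolynomial.aeval (fun ij : Fin n × Fin n => A ij.1 ij.2) φ ≠ 0) ↔
        ∀ k : Fin N, ρ k ≤ (B ^ (k : ℕ) * A).rank := by
      intro A
      simp only [S, Set.exists_range_iff, map_prod, Finset.prod_ne_zero_iff, aeval_detPolynomial,
        Finset.mem_univ, true_implies, le_rank_iff_exists_det_ne_zero, Matrix.mul_assoc]
      constructor
      · rintro ⟨LQ, h⟩ k
        exact ⟨_, _, h k⟩
      · intro h
        choose L Q hLQ using h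
        exact ⟨fun k => (L k, Q k), hLQ⟩
    refine holdsGenerically_of_lines S (fun A hA hφ => htype A hA fun k => ?_) fun A hA => ?_
    · obtain ⟨v', hv', htri⟩ := hadapted A hA
      have hle := hv'.finrank_range_pow_mul_le hR htri k
      rw [← rank_pow_mul] at hle
      rcases Nat.lt_or_ge k N with hk | hk
      · have := (hS A).1 hφ ⟨k, hk⟩
        dsimp only [ρ] at this
        omega
      · have h0 : powRank c k = 0 := by
          have h1 := rank_pow_mul 1 B k
          rw [← hv'.finrank_range_pow]
          rw [pow_eq_zero_of_le hk hN, zero_mul, Matrix.rank_zero, Matrix.mulVecLin_one] at h1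
          exact h1.symm
        omega
    · obtain ⟨v', hv', htri⟩ := hadapted A hA
      -- The maximizer is built in the basis adapted to `A`, so the whole line through both is
      -- triangular there.
      obtain ⟨A', htri', hrank⟩ := exists_mem_nilpotentCommutator_isTriangular hv' hR
      refine ⟨A', (hS A').2 fun k => ?_, fun s => hmem hv' ?_⟩
      · have := hrank k
        dsimp only [ρ]
        omega
      · have h1 : ((1 - s) • A + s • A').mulVecLin =
            (1 - s) • A.mulVecLin + s • A'.mulVecLin := by
          simp only [← Matrix.toLin'_apply', map_add, map_smul]
        rw [h1]
        exact htri.add_smul htri' _ _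
  · obtain ⟨A, htri, hrank⟩ := exists_mem_nilpotentCommutator_isTriangular hv hR
    exact ⟨A, hmem hv htri, htype A (hmem hv htri) hrank⟩
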